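/- Let $A$ be a free abelian group of infinite rank. An automorphism $t\in\operatorname{Aut}A$ is said to be of type $\tau$ if there is a basis $(x_i,y_i : i\in I)$ of $A$ such that $t x_i=x_i+y_i$ and $t y_i=y_i$ for all $i\in I$; an automorphism is of type $\tau^m$ if it is the $m$-th power of an automorphism of type $\tau$. Then for every natural number $m\ge 2$, the normal closure in $\operatorname{Aut}A$ of any automorphism of type $\tau^m$ is equal to the principal congruence subgroup $\Gamma_A(m)$ of level $m$, that is, to the kernel of the homomorphism $\operatorname{Aut}A\to\operatorname{Aut}(A/mA)$ induced by the natural homomorphism $A\to A/mA$ (equivalently, to the group of all $\varphi\in\operatorname{Aut}A$ with $\varphi(a)\equiv a \pmod{mA}$ for all $a\in A$). -/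

import Mathlib

universe u v

/-- The group `Aut A` of automorphisms of an abelian group `A`, with composition as multiplication.
Every additive bijection `A → A` is `ℤ`-linear, so this is the group `A ≃ₗ[ℤ] A`. -/
abbrev AutGroup (A : Type u) [AddCommGroup A] : Type u := A ≃ₗ[ℤ] A

/-- The subgroup `mA` of an abelian group `A`. -/
def multiplesSubgroup (A : Type u) [AddCommGroup A] (m : ℕ) : Submodule ℤ A :=
  LinearMap.range (LinearMap.lsmul ℤ A (m : ℤ))

theorem mem_multiplesSubgroup {A : Type u} [AddCommGroup A] {m : ℕ} {a : A} :
    a ∈ multiplesSubgroup A m ↔ ∃ c : A, m • c = a := by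
  simp [multiplesSubgroup]

theorem map_multiplesSubgroup {A : Type u} [AddCommGroup A] (m : ℕ) (f : AutGroup A) :
    (multiplesSubgroup A m).map (f : A →ₗ[ℤ] A) = multiplesSubgroup A m := by
  ext a
  simp only [Submodule.mem_map, mem_multiplesSubgroup]
  constructor
  · rintro ⟨x, ⟨c, rfl⟩, rfl⟩
    exact ⟨f c, (map_nsmul f m c).symm⟩
  · rintro ⟨c, rfl⟩
    exact ⟨m • f.symm c, ⟨_, rfl⟩, by simp⟩

/-- The homomorphism `Aut A → Aut (A / mA)` induced by the natural homomorphism `A → A / mA`. -/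
def reductionHom (A : Type u) [AddCommGroup A] (m : ℕ) :
    AutGroup A →* AutGroup (A ⧸ multiplesSubgroup A m) where
  toFun f := Submodule.Quotient.equiv _ _ f (map_multiplesSubgroup m f)
  map_one' := by
    ext q
    obtain ⟨a, rfl⟩ := Submodule.Quotient.mk_surjective _ q
    rfl
  map_mul' f g := by
    ext q
    obtain ⟨a, rfl⟩ := Submodule.Quotient.mk_surjective _ q
    rfl

/-- The principal congruence subgroup `Γ_A(m)` of `Aut A` of level `m`. -/
def principalCongruenceSubgroup (A : Type u) [AddCommGroup A] (m : ℕ) : Subgroup (AutGroup A) :=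
  (reductionHom A m).ker

/-- `f ∈ Γ_A(m)` if and only if `f a ≡ a (mod mA)` for all `a`. -/
theorem mem_principalCongruenceSubgroup {A : Type u} [AddCommGroup A] {m : ℕ} {f : AutGroup A} :
    f ∈ principalCongruenceSubgroup A m ↔ ∀ a : A, f a - a ∈ multiplesSubgroup A m := by
  rw [principalCongruenceSubgroup, MonoidHom.mem_ker]
  constructor
  · intro h a
    have h' := LinearEquiv.congr_fun h (Submodule.Quotient.mk a)
    exact (Submodule.Quotient.eq _).1 h'
  · intro h
    ext q
    obtain ⟨a, rfl⟩ := Submodule.Quotient.mk_surjective _ q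
    exact (Submodule.Quotient.eq _).2 (h a)

/-- `t` has type `τ`: there is a basis `(x_i, y_i : i ∈ I)` of `A` (with `x_i = b (inl i)` and
`y_i = b (inr i)`) such that `t x_i = x_i + y_i` and `t y_i = y_i` for all `i ∈ I`. -/
def IsTypeTau {A : Type u} [AddCommGroup A] (t : AutGroup A) : Prop :=
  ∃ (I : Type u) (b : Module.Basis (I ⊕ I) ℤ A),
    ∀ i : I, t (b (Sum.inl i)) = b (Sum.inl i) + b (Sum.inr i) ∧ t (b (Sum.inr i)) = b (Sum.inr i)

/-- The universe of the index set in `IsTypeTau` is immaterial. -/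
theorem IsTypeTau.of_basis {A : Type u} [AddCommGroup A] {t : AutGroup A} {I : Type v}
    (b : Module.Basis (I ⊕ I) ℤ A)
    (h : ∀ i : I, t (b (Sum.inl i)) = b (Sum.inl i) + b (Sum.inr i) ∧
      t (b (Sum.inr i)) = b (Sum.inr i)) : IsTypeTau t := by
  have hinj : Function.Injective fun i : I => b (Sum.inl i) :=
    b.injective.comp Sum.inl_injective
  let e := Equiv.ofInjective _ hinj
  refine ⟨Set.range fun i : I => b (Sum.inl i), b.reindex (Equiv.sumCongr e e), fun j => ?_⟩
  simpa using h (e.symm j)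

/-- `f` has type `τ ^ m`: it is the `m`-th power of an automorphism of type `τ`. -/
def IsTypeTauPow {A : Type u} [AddCommGroup A] (m : ℕ) (f : AutGroup A) : Prop :=
  ∃ t : AutGroup A, IsTypeTau t ∧ f = t ^ m

/-! In infinite rank all automorphisms of type τ are conjugate, so the normal closure of `f` is `N =
tauPowClosure A m`. That `N ≤ Γ(m)` is checked on a basis. Conversely, let `g = 1 + m h` be in
`Γ(m)`.

A rank count yields as many primitive vectors x_j as the rank of `A`, with x_j and h x_j supported
in disjoint finite blocks, each containing a spare basis vector z_j
(`exists_large_disjoint_family`). A transvection in `N` changes g x_j into x_j + m k_j, where k_j =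
h x_j + z_j. Both families span summands, with retractions that each kill the other family, so a
second transvection makes `g` fix every x_j (`mem_tauPowClosure_of_split`). A complement `P` of
their span `X` is free by Eilenberg's swindle, and on P × X the map is a product of diag(u, 1), u ∈
Γ_P(m), and a shear by mφ (`mem_tauPowClosure_of_fix`).

Such shears lie in `N` because φ is a sum of four isomorphisms and a shear by an isomorphism has
type τ (`lowerShear_mem`). Whitehead's factorisation puts diag(w, w⁻¹) in `N`; with w = u ⊕ u ⊕ ⋯,
the quotient of diag(u, w, w⁻¹) by diag(1, w, w⁻¹) is diag(u, 1, 1) (`diag_mem`). -/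

open Cardinal

/-! ### Splittings and Eilenberg's swindle -/

section Isomorphisms

/-- A split monomorphism `i : X → A` with retraction `p` decomposes `A` as `ker p × X`. -/
def splitEquiv {A X : Type*} [AddCommGroup A] [AddCommGroup X] (i : X →ₗ[ℤ] A) (p : A →ₗ[ℤ] X)
    (h : ∀ x, p (i x) = x) : A ≃ₗ[ℤ] (LinearMap.ker p) × X where
  toFun a := (⟨a - i (p a), by simp [h]⟩, p a)
  map_add' a b := by ext <;> simp; abel
  map_smul' n a := by ext <;> simp [smul_sub]
  invFun q := q.1 + i q.2
  left_inv a := by simp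
  right_inv q := by
    have h1 : p q.1 = 0 := q.1.2
    ext <;> simp [h, h1]

/-- Finitely supported functions into a product are pairs of finitely supported functions. -/
noncomputable def finsuppProdEquiv (S Z W : Type*) [AddCommGroup Z] [AddCommGroup W] :
    (S →₀ Z × W) ≃ₗ[ℤ] (S →₀ Z) × (S →₀ W) :=
  LinearEquiv.ofLinearMap
    ((Finsupp.mapRange.linearMap (LinearMap.fst ℤ Z W)).prod
      (Finsupp.mapRange.linearMap (LinearMap.snd ℤ Z W)))
    ((Finsupp.mapRange.linearMap (LinearMap.inl ℤ Z W)).coprod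
      (Finsupp.mapRange.linearMap (LinearMap.inr ℤ Z W)))
    (by ext <;> simp) (by ext <;> simp)

/-- Splitting the first term off a finitely supported sequence. -/
noncomputable def finsuppNatConsEquiv (Z : Type*) [AddCommGroup Z] :
    (Z × (ℕ →₀ Z)) ≃ₗ[ℤ] (ℕ →₀ Z) :=
  ((Finsupp.uniqueLinearEquiv ℤ Z ()).symm.prodCongr (LinearEquiv.refl ℤ (ℕ →₀ Z))).trans
    ((Finsupp.sumFinsuppLEquivProdFinsupp ℤ).symm.trans
      (Finsupp.domLCongr ((Equiv.sumComm Unit ℕ).trans Equiv.natSumPUnitEquivNat)))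

theorem finsuppNatConsEquiv_mapRange {Z : Type*} [AddCommGroup Z] (w : AutGroup Z)
    (q : Z × (ℕ →₀ Z)) :
    finsuppNatConsEquiv Z (w q.1, Finsupp.mapRange.linearEquiv w q.2) =
      Finsupp.mapRange.linearEquiv w (finsuppNatConsEquiv Z q) := by
  have : ∀ n, finsuppNatConsEquiv Z (w q.1, Finsupp.mapRange.linearEquiv w q.2) n =
      Finsupp.mapRange.linearEquiv w (finsuppNatConsEquiv Z q) n := by
    intro n
    obtain ⟨s, rfl⟩ := ((Equiv.sumComm Unit ℕ).trans Equiv.natSumPUnitEquivNat).surjective n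
    rcases s with ⟨⟩ | s
    all_goals
      simp only [finsuppNatConsEquiv, LinearEquiv.trans_apply, Finsupp.domLCongr_apply,
        Finsupp.domCongr_apply, Finsupp.equivMapDomain_apply, Finsupp.mapRange.linearEquiv_apply,
        Finsupp.mapRange_apply, Equiv.symm_apply_apply, LinearEquiv.prodCongr_apply]
      simp
  exact Finsupp.ext this

theorem rank_prod_of_infinite {P Q : Type u} [AddCommGroup P] [AddCommGroup Q] [Module.Free ℤ P]
    [Module.Free ℤ Q] {c : Cardinal.{u}} (hc : ℵ₀ ≤ c) (hP : Module.rank ℤ P = c)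
    (hQ : Module.rank ℤ Q = c) : Module.rank ℤ (P × Q) = c := by
  rw [rank_prod', hP, hQ, add_eq_self hc]

theorem rank_finsupp_nat_of_infinite {P : Type u} [AddCommGroup P] [Module.Free ℤ P]
    {c : Cardinal.{u}} (hc : ℵ₀ ≤ c) (hP : Module.rank ℤ P = c) :
    Module.rank ℤ (ℕ →₀ P) = c := by
  rw [rank_finsupp]
  simp [hP, aleph0_mul_eq hc]

/-- Eilenberg's swindle: a direct summand of a free group is absorbed by a large free group. -/
theorem nonempty_prod_equiv_of_summand {Z W A X : Type u} [AddCommGroup Z] [AddCommGroup W]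
    [AddCommGroup A] [AddCommGroup X] [Module.Free ℤ A] [Module.Free ℤ X] {c : Cardinal.{u}}
    (hc : ℵ₀ ≤ c) (hA : Module.rank ℤ A = c) (hX : Module.rank ℤ X = c)
    (e : A ≃ₗ[ℤ] Z × W) : Nonempty ((Z × X) ≃ₗ[ℤ] X) := by
  obtain ⟨d⟩ := nonempty_linearEquiv_of_rank_eq
    (hX.trans (rank_finsupp_nat_of_infinite hc hA).symm)
  -- X ≅ A^(ℕ) ≅ Z^(ℕ) × W^(ℕ), and Z^(ℕ) absorbs one more copy of Z.
  let d' : X ≃ₗ[ℤ] (ℕ →₀ Z) × (ℕ →₀ W) :=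
    d.trans ((Finsupp.mapRange.linearEquiv e).trans (finsuppProdEquiv ℕ Z W))
  exact ⟨((LinearEquiv.refl ℤ Z).prodCongr d').trans ((LinearEquiv.prodAssoc ℤ Z _ _).symm.trans
    (((finsuppNatConsEquiv Z).prodCongr (LinearEquiv.refl ℤ (ℕ →₀ W))).trans d'.symm))⟩

/-- If the kernel of a retraction contains a large free direct summand of `A`, then it is free. -/
theorem nonempty_ker_equiv {A X : Type u} [AddCommGroup A] [AddCommGroup X] [Module.Free ℤ A]
    [Module.Free ℤ X] {c : Cardinal.{u}} (hc : ℵ₀ ≤ c) (hA : Module.rank ℤ A = c)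
    (hX : Module.rank ℤ X = c) (i j : X →ₗ[ℤ] A) (p q : A →ₗ[ℤ] X) (hpi : ∀ x, p (i x) = x)
    (hqj : ∀ x, q (j x) = x) (hpj : ∀ x, p (j x) = 0) :
    Nonempty (LinearMap.ker p ≃ₗ[ℤ] X) := by
  let j' : X →ₗ[ℤ] LinearMap.ker p := j.codRestrict _ hpj
  let q' : LinearMap.ker p →ₗ[ℤ] X := q.comp (LinearMap.ker p).subtype
  have hqj' : ∀ x, q' (j' x) = x := hqj
  let e := splitEquiv j' q' hqj'
  -- ker p ≅ ker q' × X, and this exhibits ker q' as a summand of A, so X absorbs it.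
  let e' : A ≃ₗ[ℤ] LinearMap.ker q' × (X × X) :=
    (splitEquiv i p hpi).trans ((e.prodCongr (LinearEquiv.refl ℤ X)).trans
      (LinearEquiv.prodAssoc ℤ _ _ _))
  obtain ⟨f⟩ := nonempty_prod_equiv_of_summand hc hA hX e'
  exact ⟨e.trans f⟩

end Isomorphisms

/-! ### The normal closure of the automorphisms of type τ^m -/

section Closure

/-- The normal closure in `Aut M` of all automorphisms of type `τ ^ m`. -/
def tauPowClosure (M : Type u) [AddCommGroup M] (m : ℕ) : Subgroup (AutGroup M) :=
  Subgroup.normalClosure {f | IsTypeTauPow m f}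

instance (M : Type u) [AddCommGroup M] (m : ℕ) : (tauPowClosure M m).Normal :=
  Subgroup.normalClosure_normal

/-- The isomorphism of automorphism groups given by an isomorphism of groups. -/
def autCongr {M M' : Type u} [AddCommGroup M] [AddCommGroup M'] (e : M ≃ₗ[ℤ] M') :
    AutGroup M →* AutGroup M' where
  toFun f := e.symm.trans (f.trans e)
  map_one' := by ext; simp
  map_mul' f g := by ext; simp

theorem IsTypeTau.autCongr {M M' : Type u} [AddCommGroup M] [AddCommGroup M'] (e : M ≃ₗ[ℤ] M')
    {t : AutGroup M} (ht : IsTypeTau t) : IsTypeTau (autCongr e t) := by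
  obtain ⟨I, b, h⟩ := ht
  exact ⟨I, b.map e, fun i => by simp [_root_.autCongr, h i]⟩

/-- Membership in `tauPowClosure` is invariant under isomorphisms. -/
theorem mem_tauPowClosure_of_conj {M M' : Type u} [AddCommGroup M] [AddCommGroup M'] {m : ℕ}
    (e : M ≃ₗ[ℤ] M') {f : AutGroup M} {f' : AutGroup M'} (h : ∀ x, f' (e x) = e (f x))
    (hf : f ∈ tauPowClosure M m) : f' ∈ tauPowClosure M' m := by
  have key : tauPowClosure M m ≤ (tauPowClosure M' m).comap (autCongr e) := by
    refine Subgroup.normalClosure_le_normal ?_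
    rintro _ ⟨t, ht, rfl⟩
    exact Subgroup.subset_normalClosure ⟨autCongr e t, ht.autCongr e, map_pow _ _ _⟩
  have hf' : f' = autCongr e f := by
    ext y
    obtain ⟨x, rfl⟩ := e.surjective y
    simp [h, autCongr]
  exact hf' ▸ key hf

theorem autGroup_pow_apply {M : Type u} [AddCommGroup M] {t : AutGroup M} {x y : M}
    (hx : t x = x + y) (hy : t y = y) (n : ℕ) : (t ^ n) x = x + n • y := by
  have h : ∀ n, (t ^ n) y = y := fun n => by
    induction n with
    | zero => simp
    | succ n ih => rw [pow_succ, LinearEquiv.mul_apply, hy, ih]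
  induction n with
  | zero => simp
  | succ n ih => rw [pow_succ, LinearEquiv.mul_apply, hx, map_add, ih, h, succ_nsmul, add_assoc]

theorem IsTypeTauPow.mem_principalCongruenceSubgroup {M : Type u} [AddCommGroup M] {m : ℕ}
    {f : AutGroup M} (hf : IsTypeTauPow m f) : f ∈ principalCongruenceSubgroup M m := by
  obtain ⟨t, ⟨I, b, h⟩, rfl⟩ := hf
  have key : ∀ a, (multiplesSubgroup M m).mkQ ((t ^ m) a) = (multiplesSubgroup M m).mkQ a := by
    intro a
    refine LinearMap.congr_fun (f := (multiplesSubgroup M m).mkQ ∘ₗ (t ^ m).toLinearMap) ?_ a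
    refine b.ext fun i => ?_
    simp only [LinearMap.comp_apply, LinearEquiv.coe_coe]
    rcases i with i | i
    · rw [autGroup_pow_apply (h i).1 (h i).2, Submodule.mkQ_apply, Submodule.mkQ_apply,
        Submodule.Quotient.eq, add_sub_cancel_left]
      exact mem_multiplesSubgroup.2 ⟨_, rfl⟩
    · rw [autGroup_pow_apply (x := b (Sum.inr i)) (y := 0) (by simp [h i]) (by simp), smul_zero,
        add_zero]
  exact _root_.mem_principalCongruenceSubgroup.2 fun a => (Submodule.Quotient.eq _).1 (key a)

theorem tauPowClosure_le (M : Type u) [AddCommGroup M] (m : ℕ) :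
    tauPowClosure M m ≤ principalCongruenceSubgroup M m := by
  have : (principalCongruenceSubgroup M m).Normal := MonoidHom.normal_ker _
  exact Subgroup.normalClosure_le_normal fun f hf => IsTypeTauPow.mem_principalCongruenceSubgroup hf

theorem autCongr_mem_principalCongruenceSubgroup {M M' : Type u} [AddCommGroup M] [AddCommGroup M']
    {m : ℕ} (e : M ≃ₗ[ℤ] M') {g : AutGroup M} (hg : g ∈ principalCongruenceSubgroup M m) :
    autCongr e g ∈ principalCongruenceSubgroup M' m := by
  refine mem_principalCongruenceSubgroup.2 fun y => mem_multiplesSubgroup.2 ?_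
  obtain ⟨a, ha⟩ := mem_multiplesSubgroup.1 (mem_principalCongruenceSubgroup.1 hg (e.symm y))
  exact ⟨e a, by rw [← map_nsmul, ha, map_sub]; simp [autCongr]⟩

/-- In infinite rank all automorphisms of type `τ` are conjugate. -/
theorem IsTypeTau.exists_conj {A : Type u} [AddCommGroup A] (hA : ℵ₀ ≤ Module.rank ℤ A)
    {t t' : AutGroup A} (ht : IsTypeTau t) (ht' : IsTypeTau t') :
    ∃ g : AutGroup A, t' = g * t * g⁻¹ := by
  -- Infinite rank makes |I| + |I| = |I|, so any two index sets are in bijection.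
  have hcard : ∀ (I : Type u), Module.Basis (I ⊕ I) ℤ A → #I = Module.rank ℤ A := by
    intro I b
    have h1 : #I + #I = Module.rank ℤ A := by
      rw [← b.mk_eq_rank'', mk_sum]; simp
    rcases lt_or_ge #I ℵ₀ with h | h
    · exact absurd (h1 ▸ add_lt_aleph0 h h) (not_lt.2 hA)
    · rw [← h1, add_eq_self h]
  obtain ⟨I, b, h⟩ := ht
  obtain ⟨I', b', h'⟩ := ht'
  obtain ⟨e⟩ := Cardinal.eq.1 ((hcard I b).trans (hcard I' b').symm)
  let g : AutGroup A := b.equiv b' (e.sumCongr e)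
  have hl : ∀ i, g (b (Sum.inl i)) = b' (Sum.inl (e i)) := fun i => by simp [g]
  have hr : ∀ i, g (b (Sum.inr i)) = b' (Sum.inr (e i)) := fun i => by simp [g]
  refine ⟨g, eq_mul_inv_iff_mul_eq.2 (LinearEquiv.toLinearMap_injective (b.ext fun i => ?_))⟩
  simp only [LinearEquiv.coe_coe, LinearEquiv.mul_apply]
  rcases i with i | i
  · simp only [(h i).1, map_add, hl, hr, (h' (e i)).1]
  · simp only [(h i).2, hr, (h' (e i)).2]

theorem normalClosure_singleton_eq_tauPowClosure {A : Type u} [AddCommGroup A]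
    (hA : ℵ₀ ≤ Module.rank ℤ A) {m : ℕ} {f : AutGroup A} (hf : IsTypeTauPow m f) :
    Subgroup.normalClosure {f} = tauPowClosure A m := by
  refine le_antisymm (Subgroup.normalClosure_mono (Set.singleton_subset_iff.2 hf))
    (Subgroup.normalClosure_le_normal ?_)
  obtain ⟨t, ht, rfl⟩ := hf
  rintro _ ⟨t', ht', rfl⟩
  obtain ⟨g, rfl⟩ := ht.exists_conj hA ht'
  rw [conj_pow]
  exact Subgroup.normalClosure_normal.conj_mem _
    (Subgroup.subset_normalClosure (Set.mem_singleton _)) g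

end Closure

/-! ### Elementary block automorphisms -/

section Shears

variable {P Q : Type*} [AddCommGroup P] [AddCommGroup Q]

/-- The automorphism `(p, q) ↦ (p, q + φ p)` of `P × Q`. -/
def lowerShear (φ : P →ₗ[ℤ] Q) : AutGroup (P × Q) :=
  (LinearEquiv.refl ℤ P).skewProd (LinearEquiv.refl ℤ Q) φ

@[simp]
theorem lowerShear_apply (φ : P →ₗ[ℤ] Q) (x : P × Q) : lowerShear φ x = (x.1, x.2 + φ x.1) := rfl

theorem lowerShear_add (φ ψ : P →ₗ[ℤ] Q) : lowerShear (φ + ψ) = lowerShear ψ * lowerShear φ := by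
  refine LinearEquiv.ext fun x => ?_
  simp [LinearEquiv.mul_apply, add_assoc]

theorem lowerShear_zero : lowerShear (0 : P →ₗ[ℤ] Q) = 1 := by
  refine LinearEquiv.ext fun x => ?_
  simp

/-- The automorphism `(p, q) ↦ (p + ψ q, q)` of `P × Q`. -/
def upperShear (ψ : Q →ₗ[ℤ] P) : AutGroup (P × Q) :=
  (LinearEquiv.prodComm ℤ P Q).trans ((lowerShear ψ).trans (LinearEquiv.prodComm ℤ Q P))

@[simp]
theorem upperShear_apply (ψ : Q →ₗ[ℤ] P) (x : P × Q) : upperShear ψ x = (x.1 + ψ x.2, x.2) := rfl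

end Shears

section InnerShears

variable {C P : Type*} [AddCommGroup C] [AddCommGroup P]

/-- The shear of `C × (P × P)` adding a multiple of the second copy of `P` to the first. -/
def innerUpper (C : Type*) [AddCommGroup C] (φ : P →ₗ[ℤ] P) : AutGroup (C × (P × P)) :=
  (LinearEquiv.refl ℤ C).prodCongr (upperShear φ)

/-- The shear of `C × (P × P)` adding a multiple of the first copy of `P` to the second. -/
def innerLower (C : Type*) [AddCommGroup C] (φ : P →ₗ[ℤ] P) : AutGroup (C × (P × P)) :=
  (LinearEquiv.refl ℤ C).prodCongr (lowerShear φ)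

@[simp]
theorem innerUpper_apply (φ : P →ₗ[ℤ] P) (x : C × (P × P)) :
    innerUpper C φ x = (x.1, x.2.1 + φ x.2.2, x.2.2) := rfl

@[simp]
theorem innerLower_apply (φ : P →ₗ[ℤ] P) (x : C × (P × P)) :
    innerLower C φ x = (x.1, x.2.1, x.2.2 + φ x.2.1) := rfl

theorem innerUpper_inv (φ : P →ₗ[ℤ] P) : (innerUpper C φ)⁻¹ = innerUpper C (-φ) := by
  rw [inv_eq_iff_mul_eq_one]
  refine LinearEquiv.ext fun x => ?_
  simp [LinearEquiv.mul_apply]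

theorem innerLower_inv (φ : P →ₗ[ℤ] P) : (innerLower C φ)⁻¹ = innerLower C (-φ) := by
  rw [inv_eq_iff_mul_eq_one]
  refine LinearEquiv.ext fun x => ?_
  simp [LinearEquiv.mul_apply]

end InnerShears

/-- Every endomorphism of `Y × Y` is a sum of four automorphisms. -/
theorem exists_sum_four_units {Y : Type*} [AddCommGroup Y] (φ : (Y × Y) →ₗ[ℤ] (Y × Y)) :
    ∃ u₁ u₂ u₃ u₄ : AutGroup (Y × Y),
      φ = u₁.toLinearMap + u₂.toLinearMap + u₃.toLinearMap + u₄.toLinearMap := by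
  let a := LinearMap.fst ℤ Y Y ∘ₗ φ ∘ₗ LinearMap.inl ℤ Y Y
  let b := LinearMap.fst ℤ Y Y ∘ₗ φ ∘ₗ LinearMap.inr ℤ Y Y
  let c := LinearMap.snd ℤ Y Y ∘ₗ φ ∘ₗ LinearMap.inl ℤ Y Y
  let d := LinearMap.snd ℤ Y Y ∘ₗ φ ∘ₗ LinearMap.inr ℤ Y Y
  let swap : AutGroup (Y × Y) := LinearEquiv.prodComm ℤ Y Y
  -- As matrices by rows: [a 1; 1 0] + [0 1; 1 d] + [1 b-2; 0 1] + [-1 0; c-2 -1] = [a b; c d].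
  refine ⟨upperShear a * swap, lowerShear d * swap,
    upperShear (b - 2 • LinearMap.id),
    lowerShear (2 • LinearMap.id - c) * LinearEquiv.neg ℤ, ?_⟩
  have h0 : φ ((0 : Y), (0 : Y)) = 0 := map_zero φ
  have hneg : ∀ x : Y, φ (-x, 0) = -φ (x, 0) := fun x => by rw [← map_neg]; simp
  ext x <;> simp [a, b, c, d, swap, two_smul, h0, hneg]; abel

/-! ### Shears and diagonal automorphisms in the normal closure -/

section Elementary

/-- A basis of `P` and its image under `u` form a basis of the type τ kind for the shear by `u`, and
multiplying `u` by `m` takes the `m`-th power of that shear. -/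
theorem lowerShear_equiv_mem {P Q : Type u} [AddCommGroup P] [AddCommGroup Q] [Module.Free ℤ P] (m : ℕ) (u : P ≃ₗ[ℤ] Q) :
    lowerShear (m • u.toLinearMap) ∈ tauPowClosure (P × Q) m := by
  refine Subgroup.subset_normalClosure ⟨lowerShear u.toLinearMap, ?_, ?_⟩
  · let b := Module.Free.chooseBasis ℤ P
    exact IsTypeTau.of_basis (b.prod (b.map u)) fun i => by simp
  · induction m with
    | zero => simp [lowerShear_zero]
    | succ n ih => rw [succ_nsmul, lowerShear_add, ih, pow_succ']

variable {P Q C : Type u} [AddCommGroup P] [AddCommGroup Q] [AddCommGroup C]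
  [Module.Free ℤ P] [Module.Free ℤ Q] [Module.Free ℤ C] {c : Cardinal.{u}}

theorem lowerShear_mem (hc : ℵ₀ ≤ c) (hP : Module.rank ℤ P = c) (hQ : Module.rank ℤ Q = c) (m : ℕ)
    (φ : P →ₗ[ℤ] Q) : lowerShear (m • φ) ∈ tauPowClosure (P × Q) m := by
  obtain ⟨e⟩ := nonempty_linearEquiv_of_rank_eq (hP.trans (rank_prod_of_infinite hc hQ hQ).symm)
  obtain ⟨d⟩ := nonempty_linearEquiv_of_rank_eq (hQ.trans (rank_prod_of_infinite hc hQ hQ).symm)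
  obtain ⟨u₁, u₂, u₃, u₄, h⟩ := exists_sum_four_units (d.toLinearMap ∘ₗ φ ∘ₗ e.symm.toLinearMap)
  let v : AutGroup (Q × Q) → (P ≃ₗ[ℤ] Q) := fun u => e.trans (u.trans d.symm)
  have hφ : φ = (v u₁).toLinearMap + (v u₂).toLinearMap + (v u₃).toLinearMap +
      (v u₄).toLinearMap := by
    ext x
    have := congrArg d.symm (LinearMap.congr_fun h (e x))
    simpa [v] using this
  rw [hφ]
  simp only [smul_add, lowerShear_add]
  exact mul_mem (lowerShear_equiv_mem m _) (mul_mem (lowerShear_equiv_mem m _)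
    (mul_mem (lowerShear_equiv_mem m _) (lowerShear_equiv_mem m _)))

/-- An automorphism of `A` congruent to the identity modulo `m` is `1 + m v`. -/
theorem exists_eq_add_nsmul {A : Type*} [AddCommGroup A] [Module.Free ℤ A] {m : ℕ} {f : AutGroup A}
    (hf : f ∈ principalCongruenceSubgroup A m) :
    ∃ v : A →ₗ[ℤ] A, f.toLinearMap = LinearMap.id + m • v := by
  let b := Module.Free.chooseBasis ℤ A
  choose w hw using fun i => mem_multiplesSubgroup.1 (mem_principalCongruenceSubgroup.1 hf (b i))
  refine ⟨b.constr ℤ w, b.ext fun i => ?_⟩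
  simp [hw]

theorem innerLower_mem (hc : ℵ₀ ≤ c) (hC : Module.rank ℤ C = c) (hP : Module.rank ℤ P = c) (m : ℕ)
    (φ : P →ₗ[ℤ] P) : innerLower C (m • φ) ∈ tauPowClosure (C × (P × P)) m :=
  mem_tauPowClosure_of_conj (LinearEquiv.prodAssoc ℤ C P P) (fun _ => rfl)
    (lowerShear_mem hc (rank_prod_of_infinite hc hC hP) hP m (φ ∘ₗ LinearMap.snd ℤ C P))

theorem innerUpper_mem (hc : ℵ₀ ≤ c) (hC : Module.rank ℤ C = c) (hP : Module.rank ℤ P = c) (m : ℕ)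
    (φ : P →ₗ[ℤ] P) : innerUpper C (m • φ) ∈ tauPowClosure (C × (P × P)) m :=
  mem_tauPowClosure_of_conj
    ((LinearEquiv.refl ℤ C).prodCongr (LinearEquiv.prodComm ℤ P P)) (fun _ => rfl)
    (innerLower_mem hc hC hP m φ)

/-- The Whitehead lemma relative to `m`. -/
theorem diag_inv_mem (hc : ℵ₀ ≤ c) (hC : Module.rank ℤ C = c) (hP : Module.rank ℤ P = c) {m : ℕ}
    {w : AutGroup P} (hw : w ∈ principalCongruenceSubgroup P m) {f : AutGroup (C × (P × P))}
    (hf : ∀ x, f x = (x.1, w x.2.1, w⁻¹ x.2.2)) : f ∈ tauPowClosure (C × (P × P)) m := by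
  obtain ⟨v, hv⟩ := exists_eq_add_nsmul hw
  obtain ⟨v', hv'⟩ := exists_eq_add_nsmul (inv_mem hw)
  -- This is U(w) L(w⁻¹)⁻¹ U(w) U(1)⁻¹ L(1) U(1)⁻¹, with w = 1 + mv and w⁻¹ = 1 + mv'. Modulo the
  -- normal closure the factors U(mv) and L(mv') vanish and the rest cancels.
  have hfac : f = innerUpper C LinearMap.id * innerUpper C (m • v) *
      (innerLower C (m • v') * innerLower C LinearMap.id)⁻¹ *
      (innerUpper C LinearMap.id * innerUpper C (m • v)) *
      (innerUpper C LinearMap.id)⁻¹ * innerLower C LinearMap.id *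
      (innerUpper C LinearMap.id)⁻¹ := by
    have h1 : innerUpper C LinearMap.id * innerUpper C (m • v) = innerUpper C w.toLinearMap := by
      rw [hv]
      refine LinearEquiv.ext fun x => ?_
      simp [LinearEquiv.mul_apply]; abel
    have h2 : (innerLower C (m • v') * innerLower C LinearMap.id) =
        innerLower C (w⁻¹ : AutGroup P).toLinearMap := by
      rw [hv']
      refine LinearEquiv.ext fun x => ?_
      simp [LinearEquiv.mul_apply]; abel
    rw [h1, h2, innerUpper_inv, innerLower_inv]
    refine LinearEquiv.ext fun x => ?_
    simp [LinearEquiv.mul_apply, hf]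
  have hq : QuotientGroup.mk' (tauPowClosure (C × (P × P)) m) f = 1 := by
    have hu := (QuotientGroup.eq_one_iff (N := tauPowClosure (C × (P × P)) m) _).2
      (innerUpper_mem hc hC hP m v)
    have hl := (QuotientGroup.eq_one_iff (N := tauPowClosure (C × (P × P)) m) _).2
      (innerLower_mem hc hC hP m v')
    rw [hfac]
    simp only [map_mul, map_inv, QuotientGroup.mk'_apply, hu, hl]
    group
  exact (QuotientGroup.eq_one_iff _).1 hq

/-- The infinite repetition swindle. -/
theorem diag_mem_aux {Y : Type u} [AddCommGroup Y] [Module.Free ℤ Y]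
    (hc : ℵ₀ ≤ c) (hY : Module.rank ℤ Y = c) {m : ℕ}
    {u : AutGroup Y} (hu : u ∈ principalCongruenceSubgroup Y m)
    {f : AutGroup (Y × (Y × ((ℕ →₀ Y) × (ℕ →₀ Y))))} (hf : ∀ x, f x = (x.1, u x.2.1, x.2.2)) :
    f ∈ tauPowClosure (Y × (Y × ((ℕ →₀ Y) × (ℕ →₀ Y)))) m := by
  have hD := rank_finsupp_nat_of_infinite hc hY
  let w : AutGroup (ℕ →₀ Y) := Finsupp.mapRange.linearEquiv u
  have hw : w ∈ principalCongruenceSubgroup (ℕ →₀ Y) m := by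
    obtain ⟨v, hv⟩ := exists_eq_add_nsmul hu
    refine mem_principalCongruenceSubgroup.2 fun a => mem_multiplesSubgroup.2
      ⟨Finsupp.mapRange.linearMap v a, Finsupp.ext fun n => ?_⟩
    have := LinearMap.congr_fun hv (a n)
    simp only [LinearEquiv.coe_coe, LinearMap.add_apply, LinearMap.id_apply,
      LinearMap.smul_apply] at this
    simp [w, this]
  let f₁ : AutGroup (Y × (Y × ((ℕ →₀ Y) × (ℕ →₀ Y)))) :=
    (LinearEquiv.refl ℤ Y).prodCongr (u.prodCongr (w.prodCongr w⁻¹))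
  let f₂ : AutGroup (Y × (Y × ((ℕ →₀ Y) × (ℕ →₀ Y)))) :=
    (LinearEquiv.refl ℤ Y).prodCongr ((LinearEquiv.refl ℤ Y).prodCongr (w.prodCongr w⁻¹))
  have h₁ : f₁ ∈ tauPowClosure (Y × (Y × ((ℕ →₀ Y) × (ℕ →₀ Y)))) m := by
    let g : AutGroup (Y × ((ℕ →₀ Y) × (ℕ →₀ Y))) :=
      (LinearEquiv.refl ℤ Y).prodCongr (w.prodCongr w⁻¹)
    -- Splitting off the first term of the sequence turns `w` into u × w.
    refine mem_tauPowClosure_of_conj (f := g) ((LinearEquiv.refl ℤ Y).prodCongr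
      (((finsuppNatConsEquiv Y).symm.prodCongr (LinearEquiv.refl ℤ (ℕ →₀ Y))).trans
        (LinearEquiv.prodAssoc ℤ Y _ _))) ?_ (diag_inv_mem hc hY hD hw fun _ => rfl)
    rintro ⟨x, y, z⟩
    obtain ⟨y, rfl⟩ := (finsuppNatConsEquiv Y).surjective y
    have := finsuppNatConsEquiv_mapRange u y
    simp [f₁, g, w, ← this]
  have h₂ : f₂ ∈ tauPowClosure (Y × (Y × ((ℕ →₀ Y) × (ℕ →₀ Y)))) m := by
    let g : AutGroup ((Y × Y) × ((ℕ →₀ Y) × (ℕ →₀ Y))) :=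
      (LinearEquiv.refl ℤ (Y × Y)).prodCongr (w.prodCongr w⁻¹)
    exact mem_tauPowClosure_of_conj (f := g) (LinearEquiv.prodAssoc ℤ Y Y _) (fun _ => rfl)
      (diag_inv_mem hc (rank_prod_of_infinite hc hY hY) hD hw fun _ => rfl)
  have : f = f₁ * f₂⁻¹ := by
    rw [eq_mul_inv_iff_mul_eq]
    refine LinearEquiv.ext fun x => ?_
    simp [LinearEquiv.mul_apply, hf, f₁, f₂]
  exact this ▸ mul_mem h₁ (inv_mem h₂)

theorem diag_mem {X Y : Type u} [AddCommGroup X] [AddCommGroup Y] [Module.Free ℤ X]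
    [Module.Free ℤ Y] (hc : ℵ₀ ≤ c) (hX : Module.rank ℤ X = c) (hY : Module.rank ℤ Y = c) {m : ℕ}
    {u : AutGroup Y} (hu : u ∈ principalCongruenceSubgroup Y m) {f : AutGroup (X × Y)}
    (hf : ∀ x, f x = (x.1, u x.2)) : f ∈ tauPowClosure (X × Y) m := by
  have hD := rank_finsupp_nat_of_infinite hc hY
  obtain ⟨e⟩ := nonempty_linearEquiv_of_rank_eq (hX.trans
    (rank_prod_of_infinite hc hY (rank_prod_of_infinite hc hD hD)).symm)
  let g : AutGroup (Y × (Y × ((ℕ →₀ Y) × (ℕ →₀ Y)))) :=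
    (LinearEquiv.refl ℤ Y).prodCongr (u.prodCongr (LinearEquiv.refl ℤ _))
  let θ : (Y × (Y × ((ℕ →₀ Y) × (ℕ →₀ Y)))) ≃ₗ[ℤ] X × Y :=
    ((LinearEquiv.prodAssoc ℤ Y Y _).symm.trans
      (((LinearEquiv.prodComm ℤ Y Y).prodCongr (LinearEquiv.refl ℤ _)).trans
        (LinearEquiv.prodAssoc ℤ Y Y _))).trans
      ((LinearEquiv.prodComm ℤ Y _).trans (e.symm.prodCongr (LinearEquiv.refl ℤ Y)))
  exact mem_tauPowClosure_of_conj (f := g) θ (by rintro ⟨x, y, z⟩; simp [hf, g, θ]; exact ⟨⟨rfl, rfl⟩, rfl⟩)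
    (diag_mem_aux hc hY hu fun _ => rfl)

end Elementary

/-! ### Reduction to automorphisms fixing a large summand -/

section Reduction

/-- The automorphism `a ↦ a + i (l a)`, where `l ∘ i = 0`. -/
def transvection {A X : Type*} [AddCommGroup A] [AddCommGroup X] (i : X →ₗ[ℤ] A) (l : A →ₗ[ℤ] X)
    (h : ∀ x, l (i x) = 0) : AutGroup A where
  toFun a := a + i (l a)
  map_add' a b := by simp only [map_add]; abel
  map_smul' n a := by simp
  invFun a := a - i (l a)
  left_inv a := by simp [h]
  right_inv a := by simp [h]

theorem transvection_apply {A X : Type*} [AddCommGroup A] [AddCommGroup X] (i : X →ₗ[ℤ] A)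
    (l : A →ₗ[ℤ] X) (h : ∀ x, l (i x) = 0) (a : A) : transvection i l h a = a + i (l a) := rfl

/-- Since `g` and its inverse fix `X` pointwise, their P-to-P blocks are mutually inverse; thus `g`
is a diagonal automorphism times a lower shear divisible by `m`. -/
theorem mem_tauPowClosure_of_fix {P X : Type u} [AddCommGroup P] [AddCommGroup X]
    [Module.Free ℤ P] [Module.Free ℤ X] {c : Cardinal.{u}} (hc : ℵ₀ ≤ c)
    (hP : Module.rank ℤ P = c) (hX : Module.rank ℤ X = c) {m : ℕ} {g : AutGroup (P × X)}
    (hg : g ∈ principalCongruenceSubgroup (P × X) m) (hfix : ∀ x : X, g (0, x) = (0, x)) :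
    g ∈ tauPowClosure (P × X) m := by
  have hfix' : ∀ x : X, g.symm (0, x) = (0, x) := fun x => by
    rw [LinearEquiv.symm_apply_eq, hfix]
  have hsplit : ∀ (k : P) (x : X), g (k, x) = g (k, 0) + (0, x) := fun k x => by
    rw [← hfix x, ← map_add]; simp
  have hsplit' : ∀ (k : P) (x : X), g.symm (k, x) = g.symm (k, 0) + (0, x) := fun k x => by
    rw [← hfix' x, ← map_add]; simp
  obtain ⟨v, hv⟩ := exists_eq_add_nsmul hg
  have hv' : ∀ k, g (k, 0) = (k, 0) + m • v (k, 0) := fun k => LinearMap.congr_fun hv (k, 0)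
  let d : P →ₗ[ℤ] P := LinearMap.fst ℤ P X ∘ₗ g.toLinearMap ∘ₗ LinearMap.inl ℤ P X
  let d' : P →ₗ[ℤ] P := LinearMap.fst ℤ P X ∘ₗ g.symm.toLinearMap ∘ₗ LinearMap.inl ℤ P X
  let u : AutGroup P := LinearEquiv.ofLinearMap d d'
    (LinearMap.ext fun k => by
      have h1 : g (g.symm (k, 0)) = (k, 0) := g.apply_symm_apply _
      have h2 := congrArg Prod.fst (hsplit (g.symm (k, 0)).1 (g.symm (k, 0)).2)
      simp only [Prod.mk.eta, h1, Prod.fst_add, add_zero] at h2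
      simp [d, d', ← h2])
    (LinearMap.ext fun k => by
      have h1 : g.symm (g (k, 0)) = (k, 0) := g.symm_apply_apply _
      have h2 := congrArg Prod.fst (hsplit' (g (k, 0)).1 (g (k, 0)).2)
      simp only [Prod.mk.eta, h1, Prod.fst_add, add_zero] at h2
      simp [d, d', ← h2])
  have hu : ∀ k, u k = (g (k, 0)).1 := fun k => rfl
  have huΓ : u ∈ principalCongruenceSubgroup P m :=
    mem_principalCongruenceSubgroup.2 fun k => mem_multiplesSubgroup.2
      ⟨(v (k, 0)).1, by rw [hu, hv']; simp⟩
  let f : AutGroup (X × P) := (LinearEquiv.refl ℤ X).prodCongr u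
  let f' : AutGroup (P × X) := u.prodCongr (LinearEquiv.refl ℤ X)
  have hf' : f' ∈ tauPowClosure (P × X) m :=
    mem_tauPowClosure_of_conj (f := f) (LinearEquiv.prodComm ℤ X P) (fun _ => rfl)
      (diag_mem hc hX hP huΓ fun _ => rfl)
  have hl := lowerShear_mem hc hP hX m (LinearMap.snd ℤ P X ∘ₗ v ∘ₗ LinearMap.inl ℤ P X)
  have hfac : g = f' * lowerShear (m • (LinearMap.snd ℤ P X ∘ₗ v ∘ₗ LinearMap.inl ℤ P X)) := by
    refine LinearEquiv.ext fun x => ?_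
    obtain ⟨k, x⟩ := x
    rw [hsplit]
    refine Prod.ext ?_ ?_
    · simp [LinearEquiv.mul_apply, f', hu]
    · simp [LinearEquiv.mul_apply, f', hv', add_comm]
  exact hfac ▸ mul_mem hf' hl

variable {A X : Type u} [AddCommGroup A] [AddCommGroup X] [Module.Free ℤ A] [Module.Free ℤ X]
  {c : Cardinal.{u}}

/-- In the splitting A ≅ ker p × X the transvection is a lower shear. The maps `j` and `q` serve to
make ker p free of rank `c`. -/
theorem transvection_mem (hc : ℵ₀ ≤ c) (hA : Module.rank ℤ A = c) (hX : Module.rank ℤ X = c)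
    (i j : X →ₗ[ℤ] A) (p q : A →ₗ[ℤ] X) (hpi : ∀ x, p (i x) = x) (hqj : ∀ x, q (j x) = x)
    (hpj : ∀ x, p (j x) = 0) (m : ℕ) (l : A →ₗ[ℤ] X) (hl : ∀ x, l (i x) = 0) :
    transvection i (m • l) (by simp [hl]) ∈ tauPowClosure A m := by
  obtain ⟨d⟩ := nonempty_ker_equiv hc hA hX i j p q hpi hqj hpj
  have : Module.Free ℤ (LinearMap.ker p) := Module.Free.of_equiv d.symm
  have hK : Module.rank ℤ (LinearMap.ker p) = c := d.rank_eq.trans hX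
  refine mem_tauPowClosure_of_conj (splitEquiv i p hpi).symm ?_
    (lowerShear_mem hc hK hX m (l ∘ₗ (LinearMap.ker p).subtype))
  rintro ⟨k, x⟩
  simp [transvection_apply, splitEquiv, hl, add_assoc]

/-- The transvection a ↦ a - m j(p a) carries i x + m j x back to i x, so its product with `g` fixes
the summand i(X) pointwise. -/
theorem mem_tauPowClosure_of_split (hc : ℵ₀ ≤ c) (hA : Module.rank ℤ A = c)
    (hX : Module.rank ℤ X = c) (i j : X →ₗ[ℤ] A) (p q : A →ₗ[ℤ] X) (hpi : ∀ x, p (i x) = x)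
    (hqj : ∀ x, q (j x) = x) (hpj : ∀ x, p (j x) = 0) (hqi : ∀ x, q (i x) = 0) {m : ℕ}
    {g : AutGroup A} (hg : g ∈ principalCongruenceSubgroup A m)
    (hgi : ∀ x, g (i x) = i x + m • j x) : g ∈ tauPowClosure A m := by
  obtain ⟨d⟩ := nonempty_ker_equiv hc hA hX i j p q hpi hqj hpj
  have : Module.Free ℤ (LinearMap.ker p) := Module.Free.of_equiv d.symm
  have hK : Module.rank ℤ (LinearMap.ker p) = c := d.rank_eq.trans hX
  have ht := transvection_mem hc hA hX j i q p hqj hpi hqi m (-p) (by simp [hpj])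
  set t := transvection j (m • (-p)) (by simp [hpj])
  have htg : ∀ x, (t * g) (i x) = i x := fun x => by
    simp [t, LinearEquiv.mul_apply, hgi, transvection_apply, hpi, hpj]
  let e := splitEquiv i p hpi
  have hei : ∀ x, e.symm (0, x) = i x := fun x => by simp [e, splitEquiv]
  have hmem : t * g ∈ principalCongruenceSubgroup A m := mul_mem (tauPowClosure_le A m ht) hg
  have key : autCongr e (t * g) ∈ tauPowClosure (LinearMap.ker p × X) m := by
    refine mem_tauPowClosure_of_fix hc hK hX
      (autCongr_mem_principalCongruenceSubgroup e hmem) fun x => ?_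
    change e ((t * g) (e.symm (0, x))) = _
    rw [hei, htg, ← hei, LinearEquiv.apply_symm_apply]
  have := mem_tauPowClosure_of_conj (f' := t * g) e.symm (by simp [autCongr]) key
  exact (Subgroup.mul_mem_cancel_left _ ht).1 this

end Reduction

/-! ### Disjoint finite blocks adapted to an endomorphism -/

section Blocks

variable {K : Type u}

theorem rank_finsupp_int (J : Type u) : Module.rank ℤ (J →₀ ℤ) = #J := by
  rw [rank_finsupp_self, lift_uzero]

/-- Every nonzero vector is a multiple of a primitive one. -/
theorem exists_primitive {v : K →₀ ℤ} (hv : v ≠ 0) :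
    ∃ (d : ℤ) (x : K →₀ ℤ) (μ : (K →₀ ℤ) →ₗ[ℤ] ℤ), d ≠ 0 ∧ v = d • x ∧ μ x = 1 := by
  -- The values of all functionals at `v` form an ideal; its generator is the content of `v` and is
  -- itself attained by some functional.
  let I : Ideal ℤ := LinearMap.range (LinearMap.applyₗ (R := ℤ) (M₂ := ℤ) v)
  obtain ⟨d, hd⟩ := IsPrincipalIdealRing.principal I
  have hdI : d ∈ I := hd ▸ Submodule.mem_span_singleton_self d
  obtain ⟨μ, hμ⟩ := hdI
  have hdvd : ∀ s, d ∣ v s := fun s => by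
    have : v s ∈ I := ⟨Finsupp.lapply s, rfl⟩
    rw [hd] at this
    exact Ideal.mem_span_singleton.1 this
  have hx : v = d • v.mapRange (fun a => a / d) (Int.zero_ediv d) :=
    Finsupp.ext fun s => by simpa using (Int.mul_ediv_cancel' (hdvd s)).symm
  have hd0 : d ≠ 0 := by
    rintro rfl
    exact hv (by rw [hx, zero_smul])
  refine ⟨d, _, μ, hd0, hx, ?_⟩
  have h1 : μ v = d := hμ
  rw [hx, map_smul, smul_eq_mul] at h1
  exact (mul_eq_left₀ hd0).1 h1

/-- A finite set of coordinates supporting a primitive vector `x` and its image under `h`, with a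
further coordinate `z` to spare. -/
structure Block (h : (K →₀ ℤ) →ₗ[ℤ] (K →₀ ℤ)) where
  F : Finset K
  x : K →₀ ℤ
  z : K
  z_mem : z ∈ F
  x_support : x.support ⊆ F
  h_support : (h x).support ⊆ F
  x_z : x z = 0
  h_z : h x z = 0
  μ : (K →₀ ℤ) →ₗ[ℤ] ℤ
  μ_x : μ x = 1

/-- Vectors supported off `U` have rank |K|, so applying `h` and restricting to `U` cannot be
injective. Dividing a kernel vector by its content keeps it and its image off `U`. -/
theorem exists_block_disjoint [Infinite K] (h : (K →₀ ℤ) →ₗ[ℤ] (K →₀ ℤ)) (U : Set K)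
    (hU : #U < #K) : ∃ B : Block h, Disjoint (B.F : Set K) U := by
  classical
  let φ : ((Uᶜ : Set K) →₀ ℤ) →ₗ[ℤ] (U →₀ ℤ) :=
    Finsupp.lcomapDomain (Subtype.val : U → K) Subtype.val_injective ∘ₗ h ∘ₗ
      Finsupp.lmapDomain ℤ ℤ (Subtype.val : (Uᶜ : Set K) → K)
  have hφ : ¬ Function.Injective φ := fun hinj => by
    have := LinearMap.rank_le_of_injective φ hinj
    rw [rank_finsupp_int, rank_finsupp_int, mk_compl_of_infinite U hU] at this
    exact absurd this (not_le.2 hU)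
  obtain ⟨w, hw, hw0⟩ : ∃ w, φ w = 0 ∧ w ≠ 0 := by
    by_contra! hcon
    exact hφ ((injective_iff_map_eq_zero φ).2 hcon)
  let v : K →₀ ℤ := Finsupp.mapDomain Subtype.val w
  have hv : v ≠ 0 := fun h0 =>
    hw0 (Finsupp.mapDomain_injective Subtype.val_injective (by rw [Finsupp.mapDomain_zero]; exact h0))
  have hvU : ∀ s ∈ U, v s = 0 := fun s hs =>
    Finsupp.mapDomain_of_notMem_range _ _ (by simpa using hs)
  have hhvU : ∀ s ∈ U, h v s = 0 := fun s hs => DFunLike.congr_fun hw ⟨s, hs⟩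
  obtain ⟨d, x, μ, hd, hvx, hμ⟩ := exists_primitive hv
  have hxU : ∀ s ∈ U, x s = 0 := fun s hs => by
    have := hvU s hs
    simpa [hvx, hd] using this
  have hhxU : ∀ s ∈ U, h x s = 0 := fun s hs => by
    have := hhvU s hs
    simpa [hvx, hd] using this
  obtain ⟨z, hz⟩ : ∃ z, z ∉ U ∪ ((x.support ∪ (h x).support : Finset K) : Set K) := by
    by_contra! hcon
    have h1 := (mk_congr (Equiv.Set.univ K)).symm.le.trans
      ((mk_le_mk_of_subset fun z _ => hcon z).trans (mk_union_le _ _))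
    exact absurd h1 (not_le.2 (add_lt_of_lt (aleph0_le_mk K) hU
      ((finset_card_lt_aleph0 _).trans_le (aleph0_le_mk K))))
  simp only [Set.mem_union, Finset.mem_coe, Finset.mem_union, not_or] at hz
  refine ⟨⟨insert z (x.support ∪ (h x).support), x, z, Finset.mem_insert_self _ _,
    fun s hs => by simp_all, fun s hs => by simp_all, by simpa using hz.2.1, by simpa using hz.2.2,
    μ, hμ⟩, ?_⟩
  rw [Set.disjoint_left]
  intro s hs hsU
  simp only [Finset.coe_insert, Set.mem_insert_iff, Finset.mem_coe, Finset.mem_union,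
    Finsupp.mem_support_iff] at hs
  rcases hs with rfl | hs | hs
  · exact hz.1 hsU
  · exact hs (hxU s hsU)
  · exact hs (hhxU s hsU)

/-- A maximal disjoint family works: if it had fewer than |K| members, its finite blocks would cover
fewer than |K| coordinates, leaving room for another block. -/
theorem exists_large_disjoint_family [Infinite K] (h : (K →₀ ℤ) →ₗ[ℤ] (K →₀ ℤ)) :
    ∃ 𝓕 : Set (Block h), 𝓕.PairwiseDisjoint (fun B => (B.F : Set K)) ∧ #𝓕 = #K := by
  obtain ⟨𝓕, hmax⟩ := zorn_subset {𝓕 : Set (Block h) | 𝓕.PairwiseDisjoint fun B => (B.F : Set K)}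
    (fun c hc hchain => ⟨⋃₀ c, (Set.pairwiseDisjoint_sUnion hchain.directedOn).2 fun s hs => hc hs,
      fun s hs => Set.subset_sUnion_of_mem hs⟩)
  have hdis : 𝓕.PairwiseDisjoint fun B => (B.F : Set K) := hmax.prop
  refine ⟨𝓕, hdis, le_antisymm ?_ ?_⟩
  · refine mk_le_of_injective (f := fun B : 𝓕 => B.1.z) fun B B' hBB => Subtype.ext ?_
    by_contra hne
    have hBB' : B.1.z = B'.1.z := hBB
    exact Set.disjoint_left.1 (hdis B.2 B'.2 hne) B.1.z_mem (hBB' ▸ B'.1.z_mem)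
  · by_contra! hlt
    have hU : #(⋃ B : 𝓕, (B.1.F : Set K)) < #K := by
      refine (mk_iUnion_le_sum_mk (f := fun B : 𝓕 => (B.1.F : Set K))).trans_lt ?_
      rcases lt_or_ge #𝓕 ℵ₀ with hf | hf
      · have := lt_aleph0_iff_finite.1 hf
        refine lt_of_lt_of_le ?_ (aleph0_le_mk K)
        exact sum_lt_of_isRegular isRegular_aleph0 hf fun B => finset_card_lt_aleph0 _
      · refine lt_of_le_of_lt ?_ hlt
        calc _ ≤ Cardinal.sum fun _ : 𝓕 => ℵ₀ :=
              sum_le_sum _ _ fun B => (finset_card_lt_aleph0 _).le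
          _ = #𝓕 * ℵ₀ := by simp
          _ = #𝓕 := mul_aleph0_eq hf
    obtain ⟨B, hB⟩ := exists_block_disjoint h _ hU
    have hB' : ∀ B' ∈ 𝓕, Disjoint (B.F : Set K) (B'.F : Set K) := fun B' h' =>
      hB.mono_right (Set.subset_iUnion (fun B : 𝓕 => (B.1.F : Set K)) ⟨B', h'⟩)
    have hins : insert B 𝓕 ∈
        {𝓕 : Set (Block h) | 𝓕.PairwiseDisjoint fun B => (B.F : Set K)} :=
      hdis.insert fun B' h' _ => hB' B' h'
    have hmem : B ∈ 𝓕 := hmax.le_of_ge hins (Set.subset_insert B 𝓕) (Set.mem_insert B 𝓕)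
    exact Set.disjoint_left.1 (hB' B hmem) B.z_mem B.z_mem

/-- Functionals on disjoint coordinate blocks assemble to one linear map. -/
theorem exists_blockMap {J : Type*} (F : J → Finset K)
    (hF : Pairwise fun j j' => Disjoint (F j : Set K) (F j' : Set K))
    (μ : J → (K →₀ ℤ) →ₗ[ℤ] ℤ) : ∃ L : (K →₀ ℤ) →ₗ[ℤ] (J →₀ ℤ),
      ∀ j v, v.support ⊆ F j → L v = Finsupp.single j (μ j v) := by
  classical
  let w : K → (J →₀ ℤ) := fun s => if hs : ∃ j, s ∈ F j then
    Finsupp.single hs.choose (μ hs.choose (Finsupp.single s 1)) else 0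
  have hw : ∀ j, ∀ s ∈ F j, w s = Finsupp.single j (μ j (Finsupp.single s 1)) := by
    intro j s hs
    have hex : ∃ j, s ∈ F j := ⟨j, hs⟩
    have hj : hex.choose = j := by
      by_contra hne
      exact Set.disjoint_left.1 (hF hne) hex.choose_spec hs
    simp only [w, dif_pos hex, hj]
  refine ⟨Finsupp.linearCombination ℤ w, fun j v hv => ?_⟩
  conv_rhs => rw [← Finsupp.sum_single v]
  rw [Finsupp.linearCombination_apply, Finsupp.sum, Finsupp.sum, map_sum, Finsupp.single_finsetSum]
  refine Finset.sum_congr rfl fun s hs => ?_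
  rw [hw j s (hv hs), Finsupp.smul_single]
  congr 1
  rw [← map_smul]; simp

theorem forall_eq_of_single {J M : Type*} [AddCommGroup M] (f g : (J →₀ ℤ) →ₗ[ℤ] M)
    (h : ∀ j, f (Finsupp.single j 1) = g (Finsupp.single j 1)) (x : J →₀ ℤ) : f x = g x :=
  LinearMap.congr_fun (Finsupp.lhom_ext' fun j => LinearMap.ext_ring (h j)) x

theorem principalCongruenceSubgroup_finsupp_le [Infinite K] (m : ℕ) :
    principalCongruenceSubgroup (K →₀ ℤ) m ≤ tauPowClosure (K →₀ ℤ) m := by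
  classical
  intro g hg
  obtain ⟨h, hh⟩ := exists_eq_add_nsmul hg
  have hgx : ∀ a, g a = a + m • h a := fun a => LinearMap.congr_fun hh a
  obtain ⟨𝓕, hdis, hcard⟩ := exists_large_disjoint_family h
  have hF : Pairwise fun j j' : 𝓕 => Disjoint (j.1.F : Set K) (j'.1.F : Set K) :=
    fun j j' hne => hdis j.2 j'.2 (Subtype.coe_injective.ne hne)
  have hc : ℵ₀ ≤ #K := aleph0_le_mk K
  have hA : Module.rank ℤ (K →₀ ℤ) = #K := rank_finsupp_int K
  have hX : Module.rank ℤ (𝓕 →₀ ℤ) = #K := (rank_finsupp_int _).trans hcard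
  -- `E j` erases the spare coordinate, so functionals composed with it kill z_j.
  let E : 𝓕 → (K →₀ ℤ) →ₗ[ℤ] (K →₀ ℤ) := fun j =>
    LinearMap.id - Finsupp.lsingle j.1.z ∘ₗ Finsupp.lapply j.1.z
  have hE : ∀ j v, v j.1.z = 0 → E j v = v := fun j v hv => by simp [E, hv]
  have hEz : ∀ j, E j (Finsupp.single j.1.z 1) = 0 := fun j => by simp [E]
  obtain ⟨Mu, hMu⟩ := exists_blockMap (fun j : 𝓕 => j.1.F) hF fun j => j.1.μ ∘ₗ E j
  obtain ⟨Ze, hZe⟩ := exists_blockMap (fun j : 𝓕 => j.1.F) hF fun j => Finsupp.lapply j.1.z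
  obtain ⟨La, hLa⟩ := exists_blockMap (fun j : 𝓕 => j.1.F) hF fun j =>
    j.1.μ ∘ₗ g.symm.toLinearMap ∘ₗ E j
  -- The correction term cancels μ(h x_j), so `Pr` kills k_j = h x_j + z_j while still sending x_j
  -- to the j-th basis vector.
  obtain ⟨Pr, hPr⟩ := exists_blockMap (fun j : 𝓕 => j.1.F) hF fun j =>
    j.1.μ ∘ₗ E j - j.1.μ (h j.1.x) • Finsupp.lapply j.1.z
  let i : (𝓕 →₀ ℤ) →ₗ[ℤ] (K →₀ ℤ) := Finsupp.linearCombination ℤ fun j => j.1.x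
  let iz : (𝓕 →₀ ℤ) →ₗ[ℤ] (K →₀ ℤ) :=
    Finsupp.linearCombination ℤ fun j => Finsupp.single j.1.z 1
  let k : (𝓕 →₀ ℤ) →ₗ[ℤ] (K →₀ ℤ) := h ∘ₗ i + iz
  have hi : ∀ j, i (Finsupp.single j 1) = j.1.x := fun j => by simp [i]
  have hiz : ∀ j, iz (Finsupp.single j 1) = Finsupp.single j.1.z 1 := fun j => by simp [iz]
  have hk : ∀ j, k (Finsupp.single j 1) = h j.1.x + Finsupp.single j.1.z 1 := fun j => by
    simp [k, hi, hiz]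
  have sz : ∀ j : 𝓕, (Finsupp.single j.1.z (1 : ℤ)).support ⊆ j.1.F := fun j =>
    Finsupp.support_single_subset.trans (Finset.singleton_subset_iff.2 j.1.z_mem)
  have sk : ∀ j : 𝓕, (h j.1.x + Finsupp.single j.1.z (1 : ℤ)).support ⊆ j.1.F := fun j =>
    Finsupp.support_add.trans (Finset.union_subset j.1.h_support (sz j))
  have sg : ∀ j : 𝓕, (g j.1.x).support ⊆ j.1.F := fun j => by
    rw [hgx]
    exact Finsupp.support_add.trans (Finset.union_subset j.1.x_support
      (Finsupp.support_smul.trans j.1.h_support))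
  have gz : ∀ j : 𝓕, g j.1.x j.1.z = 0 := fun j => by simp [hgx, j.1.x_z, j.1.h_z]
  have Mu_i : ∀ x, Mu (i x) = x := forall_eq_of_single (Mu ∘ₗ i) LinearMap.id fun j => by
    simp [hi, hMu j _ j.1.x_support, hE j _ j.1.x_z, j.1.μ_x]
  have Ze_i : ∀ x, Ze (i x) = 0 := forall_eq_of_single (Ze ∘ₗ i) 0 fun j => by
    simp [hi, hZe j _ j.1.x_support, j.1.x_z]
  have Ze_iz : ∀ x, Ze (iz x) = x := forall_eq_of_single (Ze ∘ₗ iz) LinearMap.id fun j => by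
    simp [hiz, hZe j _ (sz j)]
  have La_iz : ∀ x, La (iz x) = 0 := forall_eq_of_single (La ∘ₗ iz) 0 fun j => by
    simp [hiz, hLa j _ (sz j), hEz]
  have La_g : ∀ x, La (g (i x)) = x :=
    forall_eq_of_single (La ∘ₗ g.toLinearMap ∘ₗ i) LinearMap.id fun j => by
      simp [hi, hLa j _ (sg j), hE j _ (gz j), j.1.μ_x]
  have Pr_i : ∀ x, Pr (i x) = x := forall_eq_of_single (Pr ∘ₗ i) LinearMap.id fun j => by
    simp [hi, hPr j _ j.1.x_support, hE j _ j.1.x_z, j.1.μ_x, j.1.x_z]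
  have Ze_k : ∀ x, Ze (k x) = x := forall_eq_of_single (Ze ∘ₗ k) LinearMap.id fun j => by
    simp [hk, hZe j _ (sk j), j.1.h_z, -map_add]
  have Pr_k : ∀ x, Pr (k x) = 0 := forall_eq_of_single (Pr ∘ₗ k) 0 fun j => by
    rw [LinearMap.comp_apply, hk, hPr j _ (sk j)]
    simp [hE j _ j.1.h_z, hEz, j.1.h_z]
  -- As `La` sends g x_j to the j-th basis vector, this transvection adds exactly m z_j to g x_j.
  -- The z_j-coordinate then makes the k_j span a summand, whatever h x_j is.
  have ht := transvection_mem hc hA hX iz i Ze Mu Ze_iz Mu_i Ze_i m La La_iz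
  set t := transvection iz (m • La) (by simp [La_iz])
  refine (Subgroup.mul_mem_cancel_left _ ht).1 ?_
  refine mem_tauPowClosure_of_split hc hA hX i k Pr Ze Pr_i Ze_k Pr_k Ze_i
    (mul_mem (tauPowClosure_le _ m ht) hg) fun x => ?_
  simp only [LinearEquiv.mul_apply, t, transvection_apply, LinearMap.smul_apply, La_g]
  simp [hgx, k, smul_add, add_assoc]

end Blocks

theorem mainTheorem4 {A : Type u} [AddCommGroup A] [Module.Free ℤ A]
    (hA : Cardinal.aleph0 ≤ Module.rank ℤ A) (m : ℕ) (hm : 2 ≤ m)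
    (f : AutGroup A) (hf : IsTypeTauPow m f) :
    Subgroup.normalClosure {f} = principalCongruenceSubgroup A m := by
  rw [normalClosure_singleton_eq_tauPowClosure hA hf]
  refine le_antisymm (tauPowClosure_le A m) fun g hg => ?_
  let b := Module.Free.chooseBasis ℤ A
  have : Infinite (Module.Free.ChooseBasisIndex ℤ A) := by
    rw [Cardinal.infinite_iff, b.mk_eq_rank'']
    exact hA
  exact mem_tauPowClosure_of_conj b.repr.symm (by simp [autCongr])
    (principalCongruenceSubgroup_finsupp_le m (autCongr_mem_principalCongruenceSubgroup b.repr hg))
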